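/- Let $\nu_1,\nu_2\ge 1$ be fixed integers and $\lambda>0$ a fixed real number. For each integer $M\ge 1$ coupons are drawn one at a time, independently and with replacement, from a mixture of two groups: Group 1 consists of $\nu_1M$ coupons, each of which occurs in a given trial with probability $p_1=p_1(M)>0$, and Group 2 consists of $\nu_2M$ coupons, each of which occurs with probability $p_2=p_2(M)$, where $\nu_1Mp_1+\nu_2Mp_2=1$ and $p_2/p_1=\lambda$ for every $M$. For $j=1,2$ let $T_j=T_j(M)$ be the number of trials needed until every Group $j$ coupon has been drawn at least once. Then $T_1$ and $T_2$ are almost surely finite and, as $M\to\infty$, $$\frac{T_1-(\nu_1+\lambda\nu_2)\,M\ln M}{(\nu_1+\lambda\nu_2)\,M}-\ln\nu_1\ \overset{D}{\longrightarrow}\ Y \qquad\text{and}\qquad \frac{T_2-(\lambda^{-1}\nu_1+\nu_2)\,M\ln M}{(\lambda^{-1}\nu_1+\nu_2)\,M}-\ln\nu_2\ \overset{D}{\longrightarrow}\ Y,$$ where $\overset{D}{\longrightarrow}$ denotes convergence in distribution and $Y$ is a standard Gumbel random variable, i.e. $P\{Y\le y\}=\exp(-e^{-y})$ for all $y\in\mathbb{R}$.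 -/

import Mathlib

open MeasureTheory ProbabilityTheory Filter Topology

/-- The distribution function `y ↦ exp (-exp (-y))` of the standard Gumbel law. -/
noncomputable def gumbelCDF : StieltjesFunction ℝ where
  toFun y := Real.exp (-Real.exp (-y))
  mono' := by
    intro a b h
    exact Real.exp_le_exp.2 (neg_le_neg (Real.exp_le_exp.2 (neg_le_neg h)))
  right_continuous' := by
    intro x
    have h : Continuous fun y : ℝ => Real.exp (-Real.exp (-y)) := by fun_prop
    exact h.continuousWithinAt

/-- The standard Gumbel law on `ℝ`: the measure whose distribution function is
`y ↦ exp (-exp (-y))`. -/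
noncomputable def standardGumbel : Measure ℝ := gumbelCDF.measure

theorem tendsto_gumbelCDF_atBot : Tendsto gumbelCDF atBot (𝓝 0) :=
  Real.tendsto_exp_neg_atTop_nhds_zero.comp
    (Real.tendsto_exp_atTop.comp tendsto_neg_atBot_atTop)

theorem tendsto_gumbelCDF_atTop : Tendsto gumbelCDF atTop (𝓝 1) := by
  have h : Tendsto (fun y : ℝ => Real.exp (-Real.exp (-y))) atTop (𝓝 (Real.exp (-0))) :=
    (Real.continuous_exp.tendsto _).comp Real.tendsto_exp_neg_atTop_nhds_zero.neg
  rw [neg_zero, Real.exp_zero] at h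
  exact h

instance standardGumbel_isProbabilityMeasure : IsProbabilityMeasure standardGumbel :=
  ⟨by simp [standardGumbel,
    StieltjesFunction.measure_univ _ tendsto_gumbelCDF_atBot tendsto_gumbelCDF_atTop]⟩

/-- `P{Y ≤ y} = exp (-exp (-y))` under the standard Gumbel law. -/
theorem standardGumbel_Iic (y : ℝ) :
    standardGumbel (Set.Iic y) = ENNReal.ofReal (Real.exp (-Real.exp (-y))) := by
  rw [standardGumbel, StieltjesFunction.measure_Iic _ tendsto_gumbelCDF_atBot, sub_zero]
  rfl

/-- `C 0, C 1, C 2, …` are independent draws with replacement from a mixture of two groups of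
coupons: `M₁` coupons `Sum.inl i` (Group 1), each of probability `p₁`, and `M₂` coupons `Sum.inr i`
(Group 2), each of probability `p₂`. The draw in trial number `n + 1` is `C n`. -/
structure IsCouponSampling {Ω : Type*} [MeasurableSpace Ω] (P : Measure Ω) (M₁ M₂ : ℕ)
    (p₁ p₂ : ℝ) (C : ℕ → Ω → Fin M₁ ⊕ Fin M₂) : Prop where
  measurable : ∀ n, Measurable (C n)
  indep : iIndepFun C P
  prob_group1 : ∀ n i, P.real {ω | C n ω = Sum.inl i} = p₁
  prob_group2 : ∀ n i, P.real {ω | C n ω = Sum.inr i} = p₂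

/-- The number of trials needed to detect all the coupons in `S`: the least `n` such that each
element of `S` is among the first `n` draws `C 0, …, C (n - 1)` (`⊤` if there is no such `n`). -/
noncomputable def detectionTime {Ω α : Type*} (S : Set α) (C : ℕ → Ω → α) (ω : Ω) : ℕ∞ :=
  sInf {t : ℕ∞ | ∃ n : ℕ, t = n ∧ ∀ c ∈ S, ∃ k < n, C k ω = c}

/-- The number of trials needed to detect all Group 1 coupons. -/
noncomputable def time₁ {Ω : Type*} {M₁ M₂ : ℕ} (C : ℕ → Ω → Fin M₁ ⊕ Fin M₂) : Ω → ℕ∞ :=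
  detectionTime (Set.range Sum.inl) C

/-- The number of trials needed to detect all Group 2 coupons. -/
noncomputable def time₂ {Ω : Type*} {M₁ M₂ : ℕ} (C : ℕ → Ω → Fin M₁ ⊕ Fin M₂) : Ω → ℕ∞ :=
  detectionTime (Set.range Sum.inr) C

/-! Each group can be treated alone: draws from the other group are wasted trials. Total mass one
and the ratio `lam` force each of the `N = ν M` coupons of a group to have probability `p = 1 / (κ
M)`, with `κ = ν₁ + lam ν₂` or `κ = lam⁻¹ ν₁ + ν₂`. Inclusion-exclusion gives `P(T ≤ n) = ∑ (-1)^j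
(N choose j) (1 - j p)^n` (`measureReal_allSeen`). For `n = ⌊κ M (ln N + y)⌋` the quantity `N exp
(-n p)`, roughly the mean number of missing coupons, tends to `c = exp (-y)`, while `n p² → 0`. The
`j`-th term then tends to `(-c)^j / j!`, and dominated convergence sums the series to `exp (-c)`
(`tendsto_sum_choose_mul_pow`), the Gumbel distribution function at `y`. The shift `ln ν` comes from
`ln N = ln M + ln ν`. -/

/-- Intervals `(a, b]` form a π-system containing arbitrarily small neighbourhoods of every point,
so convergence of their masses implies weak convergence. -/
theorem tendsto_probabilityMeasure_of_tendsto_Iic {ι : Type*} {l : Filter ι}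
    [l.IsCountablyGenerated] {μ : ι → ProbabilityMeasure ℝ} {ν : ProbabilityMeasure ℝ}
    (h : ∀ y, Tendsto (fun i => (μ i : Measure ℝ).real (Set.Iic y)) l
      (𝓝 ((ν : Measure ℝ).real (Set.Iic y)))) :
    Tendsto μ l (𝓝 ν) := by
  have hIoc : ∀ (m : ProbabilityMeasure ℝ) {a b : ℝ}, a < b →
      (m : Measure ℝ).real (Set.Ioc a b) =
        (m : Measure ℝ).real (Set.Iic b) - (m : Measure ℝ).real (Set.Iic a) := by
    intro m a b hab
    rw [← Set.Iic_sdiff_Iic, measureReal_sdiff (Set.Iic_subset_Iic.2 hab.le) measurableSet_Iic]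
  refine (isPiSystem_Ioc (id : ℝ → ℝ) id).tendsto_probabilityMeasure_of_tendsto_of_mem ?_ ?_ ?_
  · rintro s ⟨a, b, -, rfl⟩
    exact measurableSet_Ioc
  · intro u hu x hx
    obtain ⟨ε, hε, hball⟩ := Metric.isOpen_iff.1 hu x hx
    refine ⟨Set.Ioc (x - ε / 2) (x + ε / 2), ⟨_, _, by simp only [id]; linarith, rfl⟩,
      Ioc_mem_nhds (by linarith) (by linarith), fun z hz => hball ?_⟩
    rw [Metric.mem_ball, Real.dist_eq, abs_lt]
    constructor <;> linarith [hz.1, hz.2]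
  · rintro s ⟨a, b, hab, rfl⟩
    rw [← NNReal.tendsto_coe]
    change Tendsto (fun i => (μ i : Measure ℝ).real (Set.Ioc a b)) l
      (𝓝 ((ν : Measure ℝ).real (Set.Ioc a b)))
    simp only [hIoc _ (show a < b from hab)]
    exact (h b).sub (h a)

/-! ### Detection times and inclusion-exclusion -/

theorem setOf_allSeen_eq_compl {Ω α : Type*} {C : ℕ → Ω → α} {S : Finset α} (n : ℕ) :
    {ω | ∀ c ∈ S, ∃ k < n, C k ω = c} = (⋃ c ∈ S, {ω | ∀ k < n, C k ω ≠ c})ᶜ := by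
  ext ω; simp

theorem detectionTime_le_natCast_iff {Ω α : Type*} {C : ℕ → Ω → α} {S : Set α} {ω : Ω} {n : ℕ} :
    detectionTime S C ω ≤ n ↔ ∀ c ∈ S, ∃ k < n, C k ω = c := by
  constructor
  · intro h
    have hne : {t : ℕ∞ | ∃ n : ℕ, t = n ∧ ∀ c ∈ S, ∃ k < n, C k ω = c}.Nonempty := by
      by_contra hcon
      rw [Set.not_nonempty_iff_eq_empty] at hcon
      simp [detectionTime, hcon] at h
    obtain ⟨m, hm, hS⟩ := csInf_mem hne
    have hmn : m ≤ n := by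
      have : (m : ℕ∞) ≤ n := hm ▸ h
      exact_mod_cast this
    intro c hc
    obtain ⟨k, hk, hkc⟩ := hS c hc
    exact ⟨k, hk.trans_le hmn, hkc⟩
  · intro h
    exact sInf_le ⟨n, rfl, h⟩

section Coverage

variable {Ω α : Type*} [MeasurableSpace Ω] [MeasurableSpace α] [MeasurableSingletonClass α]
  {P : Measure Ω} [IsProbabilityMeasure P] {C : ℕ → Ω → α} {S : Finset α} {p : ℝ}

/-- Independent draws each miss `t` with probability `1 - |t| p`. A general `t` is needed for the
intersections in inclusion-exclusion. -/
theorem measureReal_forall_notMem (hm : ∀ n, Measurable (C n)) (hind : iIndepFun C P)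
    (hp : ∀ n, ∀ c ∈ S, P.real {ω | C n ω = c} = p) {t : Finset α} (ht : t ⊆ S) (n : ℕ) :
    P.real {ω | ∀ k < n, C k ω ∉ t} = (1 - t.card * p) ^ n := by
  have hmeas : MeasurableSet ((t : Set α)ᶜ) := t.measurableSet.compl
  have hset : {ω | ∀ k < n, C k ω ∉ t} = ⋂ k ∈ Finset.range n, C k ⁻¹' (t : Set α)ᶜ := by
    ext ω; simp
  have hone : ∀ k, P.real (C k ⁻¹' (t : Set α)ᶜ) = 1 - t.card * p := by
    intro k
    rw [Set.preimage_compl, probReal_compl_eq_one_sub (hm k t.measurableSet),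
      ← sum_measureReal_preimage_singleton t (fun y _ => hm k (measurableSet_singleton y)),
      Finset.sum_congr rfl (fun c hc => show P.real (C k ⁻¹' {c}) = p from hp k c (ht hc)),
      Finset.sum_const, nsmul_eq_mul]
  rw [hset, measureReal_def,
    hind.measure_inter_preimage_eq_mul (Finset.range n) (fun _ _ => hmeas), ENNReal.toReal_prod,
    ← Finset.card_range n, ← Finset.prod_const, Finset.card_range]
  exact Finset.prod_congr rfl fun k _ => hone k

theorem measurableSet_unseen (hm : ∀ n, Measurable (C n)) (c : α) (n : ℕ) :
    MeasurableSet {ω | ∀ k < n, C k ω ≠ c} := by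
  have : {ω | ∀ k < n, C k ω ≠ c} = ⋂ k ∈ Finset.range n, C k ⁻¹' {c}ᶜ := by
    ext ω; simp
  rw [this]
  exact Finset.measurableSet_biInter _ fun k _ => hm k (measurableSet_singleton c).compl

theorem measurableSet_allSeen (hm : ∀ n, Measurable (C n)) (n : ℕ) :
    MeasurableSet {ω | ∀ c ∈ S, ∃ k < n, C k ω = c} := by
  rw [setOf_allSeen_eq_compl]
  exact (Finset.measurableSet_biUnion _ fun c _ => measurableSet_unseen hm c n).compl

/-- The probability that `n` draws contain every coupon of `S`, by inclusion-exclusion. -/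
theorem measureReal_allSeen (hm : ∀ n, Measurable (C n)) (hind : iIndepFun C P)
    (hp : ∀ n, ∀ c ∈ S, P.real {ω | C n ω = c} = p) (n : ℕ) :
    P.real {ω | ∀ c ∈ S, ∃ k < n, C k ω = c} =
      ∑ j ∈ Finset.range (S.card + 1), (-1) ^ j * (S.card.choose j : ℝ) * (1 - j * p) ^ n := by
  classical
  have hinter : ∀ t ∈ S.powerset, P.real (⋂ c ∈ t, {ω | ∀ k < n, C k ω ≠ c}) =
      (1 - t.card * p) ^ n := by
    intro t ht
    rw [← measureReal_forall_notMem hm hind hp (Finset.mem_powerset.1 ht) n]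
    congr 1
    ext ω
    simp only [Set.mem_iInter, Set.mem_ofPred_eq]
    exact ⟨fun h k hk hmem => h _ hmem k hk rfl, fun h c hc k hk he => h k hk (he ▸ hc)⟩
  have hpow := Finset.sum_powerset_apply_card
    (fun j : ℕ => (-1 : ℝ) ^ j * (1 - j * p) ^ n) (x := S)
  simp only [nsmul_eq_mul] at hpow
  -- Inclusion-exclusion for the union runs over nonempty `t`; the term of `∅` is the `1` produced
  -- by passing to the complement.
  have hsplit := Finset.sum_filter_add_sum_filter_not S.powerset (fun t => t.Nonempty)
    (fun t => (-1 : ℝ) ^ t.card * (1 - t.card * p) ^ n)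
  have hempty : S.powerset.filter (fun t => ¬ t.Nonempty) = {∅} := by
    ext t
    simp only [Finset.mem_filter, Finset.mem_powerset, Finset.not_nonempty_iff_eq_empty,
      Finset.mem_singleton]
    exact ⟨fun h => h.2, fun h => ⟨h ▸ Finset.empty_subset _, h⟩⟩
  rw [hempty, Finset.sum_singleton] at hsplit
  rw [setOf_allSeen_eq_compl, probReal_compl_eq_one_sub
      (Finset.measurableSet_biUnion _ fun c _ => measurableSet_unseen hm c n),
    measureReal_biUnion_eq_sum_powerset (fun c _ => measurableSet_unseen hm c n),
    Finset.sum_congr rfl (fun t ht => by rw [hinter t (Finset.mem_filter.1 ht).1])]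
  have hR : ∑ j ∈ Finset.range (S.card + 1),
      (-1) ^ j * (S.card.choose j : ℝ) * (1 - j * p) ^ n =
      ∑ t ∈ S.powerset, (-1 : ℝ) ^ t.card * (1 - t.card * p) ^ n := by
    rw [hpow]
    exact Finset.sum_congr rfl fun j _ => by ring
  rw [hR, ← hsplit]
  simp only [pow_succ, mul_neg, mul_one, neg_mul, Finset.sum_neg_distrib, Finset.card_empty,
    pow_zero, Nat.cast_zero, zero_mul, sub_zero, one_pow]
  ring

theorem measurable_detectionTime (hm : ∀ n, Measurable (C n)) :
    Measurable (detectionTime (S : Set α) C) := by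
  have hle : ∀ n : ℕ, MeasurableSet {ω | detectionTime (S : Set α) C ω ≤ n} := by
    intro n
    simp only [detectionTime_le_natCast_iff, Finset.mem_coe]
    exact measurableSet_allSeen hm n
  have hnat : ∀ n : ℕ, MeasurableSet (detectionTime (S : Set α) C ⁻¹' {(n : ℕ∞)}) := by
    intro n
    have : detectionTime (S : Set α) C ⁻¹' {(n : ℕ∞)} =
        {ω | detectionTime (S : Set α) C ω ≤ n} \
          ⋃ m ∈ Finset.range n, {ω | detectionTime (S : Set α) C ω ≤ m} := by
      ext ω
      simp only [Set.mem_preimage, Set.mem_singleton_iff, Set.mem_sdiff, Set.mem_ofPred_eq,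
        Set.mem_iUnion, Finset.mem_range, exists_prop, not_exists, not_and, not_le]
      constructor
      · intro h
        rw [h]
        exact ⟨le_rfl, fun m hm => by exact_mod_cast hm⟩
      · rintro ⟨h1, h2⟩
        lift detectionTime (S : Set α) C ω to ℕ using ne_top_of_le_ne_top (by simp) h1 with d
        norm_cast at h1 h2 ⊢
        by_contra hne
        exact lt_irrefl _ (h2 d (lt_of_le_of_ne h1 hne))
    rw [this]
    exact (hle n).diff (Finset.measurableSet_biUnion _ fun m _ => hle m)
  refine measurable_to_countable' fun x => ?_
  induction x with
  | coe n => exact hnat n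
  | top =>
    have : detectionTime (S : Set α) C ⁻¹' {⊤} =
        (⋃ n : ℕ, detectionTime (S : Set α) C ⁻¹' {(n : ℕ∞)})ᶜ := by
      ext ω
      simp only [Set.mem_preimage, Set.mem_singleton_iff, Set.mem_compl_iff, Set.mem_iUnion,
        not_exists]
      constructor
      · intro h n
        rw [h]
        exact (ENat.natCast_ne_top n).symm
      · intro h
        by_contra hne
        obtain ⟨d, hd⟩ := ENat.ne_top_iff_exists.1 hne
        exact h d hd.symm
    rw [this]
    exact (MeasurableSet.iUnion hnat).compl

/-- A given coupon is never drawn with probability at most `(1 - p)^n` for every `n`, hence zero,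
and `S` is finite. -/
theorem ae_detectionTime_ne_top (hm : ∀ n, Measurable (C n)) (hind : iIndepFun C P)
    (hp : ∀ n, ∀ c ∈ S, P.real {ω | C n ω = c} = p) (hp0 : 0 < p) :
    ∀ᵐ ω ∂P, detectionTime (S : Set α) C ω ≠ ⊤ := by
  have hc : ∀ c ∈ S, ∀ᵐ ω ∂P, ∃ k, C k ω = c := by
    intro c hcS
    have hp1 : p ≤ 1 := hp 0 c hcS ▸ measureReal_le_one
    have hbound : ∀ n : ℕ, P.real {ω | ∀ k, C k ω ≠ c} ≤ (1 - p) ^ n := by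
      intro n
      have := measureReal_forall_notMem hm hind hp (Finset.singleton_subset_iff.2 hcS) n
      rw [Finset.card_singleton, Nat.cast_one, one_mul] at this
      rw [← this]
      exact measureReal_mono fun ω h k _ => by simpa using h k
    have hlim := tendsto_pow_atTop_nhds_zero_of_lt_one (sub_nonneg.2 hp1) (sub_lt_self 1 hp0)
    have hzero : P.real {ω | ∀ k, C k ω ≠ c} = 0 :=
      le_antisymm (ge_of_tendsto' hlim hbound) measureReal_nonneg
    rw [measureReal_eq_zero_iff] at hzero
    rw [ae_iff]
    simpa using hzero
  filter_upwards [(Finset.eventually_all S).2 hc] with ω hω htop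
  choose! k hk using hω
  -- Draws are indexed from `0`, so index `k` belongs to the first `k + 1` trials.
  have : detectionTime (S : Set α) C ω ≤ ((S.sup k + 1 : ℕ) : ℕ∞) :=
    detectionTime_le_natCast_iff.2 fun c hcS =>
      ⟨k c, Nat.lt_succ_of_le (Finset.le_sup (f := k) hcS), hk c hcS⟩
  rw [htop, top_le_iff] at this
  exact ENat.natCast_ne_top _ this

end Coverage

/-! ### Poisson limit of the inclusion-exclusion sum -/

/-- Companion to `1 - x ≤ exp (-x)`. It follows from `log u ≥ 1 - 1/u` and `(1 + x + 2x²)(1 - x) = 1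
+ x²(1 - 2x) ≥ 1`. -/
theorem exp_neg_sub_two_mul_sq_le_one_sub {x : ℝ} (h1 : x ≤ 1 / 2) :
    Real.exp (-x - 2 * x ^ 2) ≤ 1 - x := by
  have hpos : 0 < 1 - x := by linarith
  rw [← Real.le_log_iff_exp_le hpos]
  refine le_trans ?_ (Real.one_sub_inv_le_log_of_pos hpos)
  have : (1 - x)⁻¹ ≤ 1 + x + 2 * x ^ 2 := by
    rw [inv_le_iff_one_le_mul₀ hpos]
    nlinarith [mul_nonneg (sq_nonneg x) (by linarith : 0 ≤ 1 - 2 * x)]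
  linarith

theorem tendsto_choose_div_pow (j : ℕ) :
    Tendsto (fun n : ℕ => (n.choose j : ℝ) / (n : ℝ) ^ j) atTop (𝓝 (1 / j.factorial)) := by
  have h : Tendsto (fun n : ℕ => (n : ℝ) * (n : ℝ)⁻¹) atTop (𝓝 1) :=
    tendsto_const_nhds.congr' <| by
      filter_upwards [eventually_ne_atTop 0] with n hn
      rw [mul_inv_cancel₀ (Nat.cast_ne_zero.2 hn)]
  simpa [div_eq_mul_inv] using tendsto_choose_mul_pow_atTop j h

/-- The inclusion-exclusion sum for the number of missing coupons in the Poisson regime. -/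
theorem tendsto_sum_choose_mul_pow {ι : Type*} {l : Filter ι} {N n : ι → ℕ} {p : ι → ℝ} {c : ℝ}
    (hN : Tendsto N l atTop) (hp : ∀ i, 0 ≤ p i) (hNp : ∀ i, N i * p i ≤ 1)
    (hp0 : Tendsto p l (𝓝 0))
    (hc : Tendsto (fun i => N i * Real.exp (-(n i * p i))) l (𝓝 c))
    (hn : Tendsto (fun i => n i * p i ^ 2) l (𝓝 0)) :
    Tendsto (fun i => ∑ j ∈ Finset.range (N i + 1),
      (-1) ^ j * ((N i).choose j : ℝ) * (1 - j * p i) ^ n i) l (𝓝 (Real.exp (-c))) := by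
  -- The binomial coefficient vanishes for `j > N`, so the sum extends to a series over a fixed
  -- index set.
  have hsum : ∀ i, ∑ j ∈ Finset.range (N i + 1),
      (-1) ^ j * ((N i).choose j : ℝ) * (1 - j * p i) ^ n i =
      ∑' j : ℕ, (-1) ^ j * ((N i).choose j : ℝ) * (1 - j * p i) ^ n i := by
    intro i
    refine (tsum_eq_sum fun j hj => ?_).symm
    rw [Nat.choose_eq_zero_of_lt (by simpa using hj)]
    simp
  have hexp : Real.exp (-c) = ∑' j : ℕ, (-c) ^ j / (j.factorial : ℝ) := by
    rw [Real.exp_eq_exp_ℝ, NormedSpace.exp_eq_tsum_div]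
  simp only [hsum, hexp]
  refine tendsto_tsum_of_dominated_convergence
    (bound := fun j : ℕ => (c + 1) ^ j / (j.factorial : ℝ)) (Real.summable_pow_div_factorial _)
    (fun j => ?_) ?_
  -- Up to sign, the term factors as `(N choose j) / N^j`, `(N exp (-n p))^j` and this ratio, which
  -- eventually lies between `exp (-2 j² n p²)` and `1`.
  · have hratio : Tendsto (fun i => ((1 - j * p i) * Real.exp (j * p i)) ^ n i) l (𝓝 1) := by
      have hlow : Tendsto (fun i => Real.exp (-(2 * (j : ℝ) ^ 2 * (n i * p i ^ 2)))) l (𝓝 1) := by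
        have := (hn.const_mul (2 * (j : ℝ) ^ 2)).neg
        rw [mul_zero, neg_zero] at this
        simpa [Function.comp_def] using (Real.continuous_exp.tendsto _).comp this
      have hsmall : ∀ᶠ i in l, (j : ℝ) * p i ≤ 1 / 2 := by
        have := hp0.const_mul (j : ℝ)
        rw [mul_zero] at this
        exact this.eventually_le_const (by norm_num)
      refine tendsto_of_tendsto_of_tendsto_of_le_of_le' hlow tendsto_const_nhds ?_ ?_
      · filter_upwards [hsmall] with i hi
        calc Real.exp (-(2 * (j : ℝ) ^ 2 * (n i * p i ^ 2)))
            = (Real.exp (-(j * p i) - 2 * (j * p i) ^ 2) * Real.exp (j * p i)) ^ n i := by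
              rw [← Real.exp_add, ← Real.exp_nat_mul]
              congr 1
              ring
          _ ≤ _ := by
              gcongr
              exact exp_neg_sub_two_mul_sq_le_one_sub hi
      · filter_upwards [hsmall] with i hi
        refine pow_le_one₀ (mul_nonneg (by linarith) (Real.exp_nonneg _)) ?_
        calc (1 - j * p i) * Real.exp (j * p i)
            ≤ Real.exp (-(j * p i)) * Real.exp (j * p i) := by
              gcongr
              exact Real.one_sub_le_exp_neg _
          _ = 1 := by rw [← Real.exp_add]; simp
    have hlim := ((((tendsto_choose_div_pow j).comp hN).mul (hc.pow j)).mul hratio).const_mul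
      ((-1 : ℝ) ^ j)
    have hval : (-1 : ℝ) ^ j * (1 / (j.factorial : ℝ) * c ^ j * 1) =
        (-c) ^ j / (j.factorial : ℝ) := by
      rw [neg_pow c]
      ring
    rw [hval] at hlim
    refine hlim.congr' ?_
    filter_upwards [hN.eventually_gt_atTop 0] with i hi
    have hNpos : (N i : ℝ) ^ j ≠ 0 := pow_ne_zero _ (Nat.cast_ne_zero.2 hi.ne')
    have hcancel : Real.exp (-(n i * p i)) ^ j * Real.exp (j * p i) ^ n i = 1 := by
      rw [← Real.exp_nat_mul, ← Real.exp_nat_mul, ← Real.exp_add, Real.exp_eq_one_iff]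
      ring
    simp only [Function.comp_apply, mul_pow]
    calc _ = (-1) ^ j * (((N i).choose j : ℝ) / (N i : ℝ) ^ j * (N i : ℝ) ^ j) *
          (1 - j * p i) ^ n i *
          (Real.exp (-(n i * p i)) ^ j * Real.exp (j * p i) ^ n i) := by ring
      _ = _ := by rw [hcancel, div_mul_cancel₀ _ hNpos, mul_one]
  -- Domination: for `j ≤ N`, `N p ≤ 1` makes `1 - j p` nonnegative, so the term is at most `(N exp
  -- (-n p))^j / j!` in norm, and eventually `N exp (-n p) ≤ c + 1`.
  · filter_upwards [hc.eventually_le_const (lt_add_one c)] with i hi j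
    rcases lt_or_ge (N i) j with hj | hj
    · rw [Nat.choose_eq_zero_of_lt hj]
      have : 0 ≤ c + 1 := le_trans (by positivity) hi
      simp only [Nat.cast_zero, mul_zero, zero_mul, norm_zero]
      positivity
    · have hx : 0 ≤ 1 - (j : ℝ) * p i := by
        have : (j : ℝ) * p i ≤ N i * p i :=
          mul_le_mul_of_nonneg_right (Nat.cast_le.2 hj) (hp i)
        linarith [hNp i]
      rw [norm_mul, norm_mul, norm_pow, norm_neg, norm_one, one_pow, one_mul, Real.norm_natCast,
        Real.norm_of_nonneg (pow_nonneg hx _)]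
      calc ((N i).choose j : ℝ) * (1 - j * p i) ^ n i
          ≤ (N i : ℝ) ^ j / j.factorial * Real.exp (-(j * p i)) ^ n i := by
            gcongr
            · exact Nat.choose_le_pow_div j (N i)
            · exact Real.one_sub_le_exp_neg _
        _ = (N i * Real.exp (-(n i * p i))) ^ j / j.factorial := by
            rw [mul_pow, ← Real.exp_nat_mul, ← Real.exp_nat_mul]
            rw [show (n i : ℝ) * -(j * p i) = j * -(n i * p i) by ring]
            ring
        _ ≤ (c + 1) ^ j / j.factorial := by gcongr

/-! ### Gumbel limit for a single group -/

theorem tendstoInDistribution_standardGumbel {ι : Type*} {l : Filter ι} [l.IsCountablyGenerated]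
    {Ω : ι → Type*} [∀ i, MeasurableSpace (Ω i)] {P : (i : ι) → Measure (Ω i)}
    [∀ i, IsProbabilityMeasure (P i)] {X : (i : ι) → Ω i → ℝ} (hX : ∀ i, Measurable (X i))
    {Ω' : Type*} [MeasurableSpace Ω'] {P' : Measure Ω'} [IsProbabilityMeasure P']
    {Y : Ω' → ℝ} (hY : HasLaw Y standardGumbel P')
    (h : ∀ y, Tendsto (fun i => (P i).real {ω | X i ω ≤ y}) l
      (𝓝 (Real.exp (-Real.exp (-y))))) :
    TendstoInDistribution X l Y P P' where
  forall_aemeasurable i := (hX i).aemeasurable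
  aemeasurable_limit := hY.aemeasurable
  tendsto := by
    refine tendsto_probabilityMeasure_of_tendsto_Iic fun y => ?_
    have hlim : (P'.map Y).real (Set.Iic y) = Real.exp (-Real.exp (-y)) := by
      rw [hY.map_eq, measureReal_def, standardGumbel_Iic, ENNReal.toReal_ofReal (Real.exp_nonneg _)]
    have hmap : ∀ i, ((P i).map (X i)).real (Set.Iic y) = (P i).real {ω | X i ω ≤ y} := by
      intro i
      rw [map_measureReal_apply (hX i) measurableSet_Iic]
      rfl
    simpa only [ProbabilityMeasure.coe_mk, hlim, hmap] using h y

/-- The inclusion-exclusion sum for a group of `N = ν M` coupons of probability `1 / (κ M)` each,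
after `⌊κ M (ln N + y)⌋` draws, tends to the Gumbel distribution function at `y`. -/
theorem tendsto_sum_choose_mul_pow_floor {ν : ℕ} (hν : 1 ≤ ν) {κ : ℝ} (hκ : 0 < κ)
    (hνκ : ν ≤ κ) (y : ℝ) :
    Tendsto (fun M : ℕ+ => ∑ j ∈ Finset.range (ν * (M : ℕ) + 1),
      (-1) ^ j * ((ν * (M : ℕ)).choose j : ℝ) * (1 - j * (κ * (M : ℕ))⁻¹) ^
        ⌊κ * (M : ℕ) * (Real.log (ν * (M : ℕ) : ℕ) + y)⌋₊) atTop
      (𝓝 (Real.exp (-Real.exp (-y)))) := by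
  have hM : Tendsto (fun M : ℕ+ => (M : ℕ)) atTop atTop := tendsto_PNat_val_atTop_atTop
  have hN : Tendsto (fun M : ℕ+ => ν * (M : ℕ)) atTop atTop :=
    hM.const_mul_atTop' hν
  have hNR : Tendsto (fun M : ℕ+ => ((ν * (M : ℕ) : ℕ) : ℝ)) atTop atTop :=
    tendsto_natCast_atTop_atTop.comp hN
  have hνpos : (0 : ℝ) < ν := by exact_mod_cast hν
  have hMpos : ∀ M : ℕ+, (0 : ℝ) < (M : ℕ) := fun M => by exact_mod_cast M.pos
  have hp : ∀ M : ℕ+, 0 < (κ * (M : ℕ))⁻¹ := fun M => inv_pos.2 (mul_pos hκ (hMpos M))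
  have hp0 : Tendsto (fun M : ℕ+ => (κ * (M : ℕ))⁻¹) atTop (𝓝 0) :=
    ((tendsto_natCast_atTop_atTop.comp hM).const_mul_atTop hκ).inv_tendsto_atTop
  have hlog : Tendsto (fun M : ℕ+ => Real.log (ν * (M : ℕ) : ℕ) + y) atTop atTop :=
    tendsto_atTop_add_const_right _ _ (Real.tendsto_log_atTop.comp hNR)
  have hlogp : Tendsto (fun M : ℕ+ => (Real.log (ν * (M : ℕ) : ℕ) + y) * (κ * (M : ℕ))⁻¹) atTop
      (𝓝 0) := by
    have h1 : Tendsto (fun M : ℕ+ => Real.log (ν * (M : ℕ) : ℕ) / ((ν * (M : ℕ) : ℕ) : ℝ)) atTop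
        (𝓝 0) := (Real.isLittleO_log_id_atTop.tendsto_div_nhds_zero).comp hNR
    have h2 := (h1.mul_const (ν / κ)).add (hp0.const_mul y)
    rw [zero_mul, mul_zero, add_zero] at h2
    refine h2.congr fun M => ?_
    have := (hMpos M).ne'
    push_cast
    field_simp
  -- Rounding down costs at most one trial, so `n p` lies within `p` below `ln N + y`.
  have hfloor : ∀ᶠ M : ℕ+ in atTop,
      (⌊κ * (M : ℕ) * (Real.log (ν * (M : ℕ) : ℕ) + y)⌋₊ : ℝ) * (κ * (M : ℕ))⁻¹ ≤
        Real.log (ν * (M : ℕ) : ℕ) + y ∧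
      Real.log (ν * (M : ℕ) : ℕ) + y - (κ * (M : ℕ))⁻¹ ≤
        (⌊κ * (M : ℕ) * (Real.log (ν * (M : ℕ) : ℕ) + y)⌋₊ : ℝ) * (κ * (M : ℕ))⁻¹ := by
    filter_upwards [hlog.eventually_ge_atTop 0] with M hM0
    have hκM : 0 < κ * (M : ℕ) := mul_pos hκ (hMpos M)
    rw [← div_eq_mul_inv, div_le_iff₀ hκM, le_div_iff₀ hκM, sub_mul, inv_mul_cancel₀ hκM.ne',
      mul_comm (Real.log _ + y)]
    exact ⟨Nat.floor_le (mul_nonneg hκM.le hM0), (Nat.sub_one_lt_floor _).le⟩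
  refine tendsto_sum_choose_mul_pow hN (fun M => (hp M).le) (fun M => ?_) hp0 ?_ ?_
  · rw [← div_eq_mul_inv, div_le_one (mul_pos hκ (hMpos M))]
    push_cast
    exact mul_le_mul_of_nonneg_right hνκ (hMpos M).le
  · have hup : Tendsto (fun M : ℕ+ => Real.exp (-y + (κ * (M : ℕ))⁻¹)) atTop
        (𝓝 (Real.exp (-y))) := by
      have := hp0.const_add (-y)
      rw [add_zero] at this
      exact (Real.continuous_exp.tendsto _).comp this
    have hNexp : ∀ M : ℕ+, ∀ x : ℝ, ((ν * (M : ℕ) : ℕ) : ℝ) * Real.exp x =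
        Real.exp (Real.log (ν * (M : ℕ) : ℕ) + x) := by
      intro M x
      rw [Real.exp_add, Real.exp_log]
      push_cast
      exact mul_pos hνpos (hMpos M)
    refine tendsto_of_tendsto_of_tendsto_of_le_of_le' tendsto_const_nhds hup ?_ ?_
    · filter_upwards [hfloor] with M h
      rw [hNexp, Real.exp_le_exp]
      linarith [h.1]
    · filter_upwards [hfloor] with M h
      rw [hNexp, Real.exp_le_exp]
      linarith [h.2]
  · refine squeeze_zero' (.of_forall fun M => by positivity) ?_ hlogp
    filter_upwards [hfloor] with M h
    rw [sq, ← mul_assoc]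
    exact mul_le_mul_of_nonneg_right h.1 (hp M).le

/-- The Gumbel limit for the detection time of a group of `ν M` coupons, each of which has
probability `1 / (κ M)`. -/
theorem detectionTime_tendstoInDistribution_gumbel {ν : ℕ} (hν : 1 ≤ ν) {κ : ℝ} (hκ : 0 < κ)
    (hνκ : ν ≤ κ) {Ω α : ℕ+ → Type*} [∀ M, MeasurableSpace (Ω M)]
    {P : (M : ℕ+) → Measure (Ω M)} [∀ M, IsProbabilityMeasure (P M)]
    [∀ M, MeasurableSpace (α M)] [∀ M, MeasurableSingletonClass (α M)]
    {C : (M : ℕ+) → ℕ → Ω M → α M} (hm : ∀ M n, Measurable (C M n))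
    (hind : ∀ M, iIndepFun (C M) (P M)) {S : (M : ℕ+) → Finset (α M)}
    (hS : ∀ M, (S M).card = ν * (M : ℕ))
    (hp : ∀ M n, ∀ c ∈ S M, (P M).real {ω | C M n ω = c} = (κ * (M : ℕ))⁻¹)
    {Ω' : Type*} [MeasurableSpace Ω'] {P' : Measure Ω'} [IsProbabilityMeasure P']
    {Y : Ω' → ℝ} (hY : HasLaw Y standardGumbel P') :
    (∀ M, ∀ᵐ ω ∂(P M), detectionTime (S M : Set (α M)) (C M) ω ≠ ⊤) ∧
      TendstoInDistribution
        (fun (M : ℕ+) (ω : Ω M) =>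
          (((detectionTime (S M : Set (α M)) (C M) ω).toNat : ℝ)
              - κ * ((M : ℕ) : ℝ) * Real.log ((M : ℕ) : ℝ))
            / (κ * ((M : ℕ) : ℝ)) - Real.log (ν : ℝ))
        atTop Y P P' := by
  have hMpos : ∀ M : ℕ+, (0 : ℝ) < (M : ℕ) := fun M => by exact_mod_cast M.pos
  have hνpos : (0 : ℝ) < ν := by exact_mod_cast hν
  have hfin : ∀ M, ∀ᵐ ω ∂(P M), detectionTime (S M : Set (α M)) (C M) ω ≠ ⊤ := fun M =>
    ae_detectionTime_ne_top (hm M) (hind M) (hp M) (inv_pos.2 (mul_pos hκ (hMpos M)))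
  refine ⟨hfin, tendstoInDistribution_standardGumbel (fun M => ?_) hY fun y => ?_⟩
  · have hT : Measurable fun ω => ((detectionTime (S M : Set (α M)) (C M) ω).toNat : ℝ) :=
      (measurable_from_top (f := fun t : ℕ∞ => (t.toNat : ℝ))).comp
        (measurable_detectionTime (hm M))
    exact ((hT.sub_const _).div_const _).sub_const _
  refine (tendsto_sum_choose_mul_pow_floor hν hκ hνκ y).congr' ?_
  have hlog : Tendsto (fun M : ℕ+ => Real.log (ν * (M : ℕ) : ℕ) + y) atTop atTop :=
    tendsto_atTop_add_const_right _ _ (Real.tendsto_log_atTop.comp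
      (tendsto_natCast_atTop_atTop.comp (tendsto_PNat_val_atTop_atTop.const_mul_atTop' hν)))
  filter_upwards [hlog.eventually_ge_atTop 0] with M hM0
  have hκM : 0 < κ * (M : ℕ) := mul_pos hκ (hMpos M)
  rw [← hS M, ← measureReal_allSeen (hm M) (hind M) (hp M), hS M]
  -- `toNat` sends `⊤` to `0`, so the two events agree only where the detection time is finite, that
  -- is almost surely.
  refine measureReal_congr ?_
  filter_upwards [hfin M] with ω hω
  refine propext ?_
  have hiff := detectionTime_le_natCast_iff (S := (S M : Set (α M))) (C := C M) (ω := ω)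
    (n := ⌊κ * (M : ℕ) * (Real.log (ν * (M : ℕ) : ℕ) + y)⌋₊)
  simp only [Finset.mem_coe] at hiff
  change (∀ c ∈ S M, _) ↔ _ - _ ≤ y
  rw [← hiff]
  obtain ⟨d, hd⟩ := ENat.ne_top_iff_exists.1 hω
  rw [← hd, Nat.cast_le, Nat.le_floor_iff (mul_nonneg hκM.le hM0), ENat.toNat_natCast,
    sub_le_iff_le_add, div_le_iff₀ hκM, Nat.cast_mul, Real.log_mul hνpos.ne' (hMpos M).ne']
  constructor <;> intro h <;> linarith

/-! ### The mixture of two groups -/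

theorem measurableSingletonClass_sum {α β : Type*} [MeasurableSpace α] [MeasurableSpace β]
    [MeasurableSingletonClass α] [MeasurableSingletonClass β] :
    MeasurableSingletonClass (α ⊕ β) where
  measurableSet_singleton
    | .inl a => by simpa using (measurableSet_singleton a).inl_image (β := β)
    | .inr b => by simpa using (measurableSet_singleton b).inr_image (α := α)

/-- The first draw always takes some value, so the probabilities of its values add up to one. The
normalisation is thus a consequence of the sampling model and is not assumed in `theorem5`. -/
theorem IsCouponSampling.total_prob_eq_one {Ω : Type*} [MeasurableSpace Ω] {P : Measure Ω}
    [IsProbabilityMeasure P] {M₁ M₂ : ℕ} {p₁ p₂ : ℝ} {C : ℕ → Ω → Fin M₁ ⊕ Fin M₂}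
    (hC : IsCouponSampling P M₁ M₂ p₁ p₂ C) : M₁ * p₁ + M₂ * p₂ = 1 := by
  have := measurableSingletonClass_sum (α := Fin M₁) (β := Fin M₂)
  have h := sum_measureReal_preimage_singleton (μ := P) Finset.univ (f := C 0)
    (fun c _ => hC.measurable 0 (measurableSet_singleton c))
  have h₁ : ∀ i, P.real (C 0 ⁻¹' {Sum.inl i}) = p₁ := hC.prob_group1 0
  have h₂ : ∀ i, P.real (C 0 ⁻¹' {Sum.inr i}) = p₂ := hC.prob_group2 0
  rw [Finset.coe_univ, Set.preimage_univ, probReal_univ, Fintype.sum_sum_type] at h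
  simpa [h₁, h₂] using h

theorem theorem5
    (ν₁ ν₂ : ℕ) (hν₁ : 1 ≤ ν₁) (hν₂ : 1 ≤ ν₂)
    (lam : ℝ) (hlam : 0 < lam)
    (p₁ p₂ : ℕ+ → ℝ) (hp₁ : ∀ M, 0 < p₁ M) (hratio : ∀ M, p₂ M / p₁ M = lam)
    {Ω : ℕ+ → Type*} [∀ M, MeasurableSpace (Ω M)]
    (P : (M : ℕ+) → Measure (Ω M)) [∀ M, IsProbabilityMeasure (P M)]
    (C : (M : ℕ+) → ℕ → Ω M → Fin (ν₁ * (M : ℕ)) ⊕ Fin (ν₂ * (M : ℕ)))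
    (hC : ∀ M, IsCouponSampling (P M) (ν₁ * (M : ℕ)) (ν₂ * (M : ℕ)) (p₁ M) (p₂ M) (C M))
    {Ω' : Type*} [MeasurableSpace Ω'] (P' : Measure Ω') [IsProbabilityMeasure P']
    (Y : Ω' → ℝ) (hY : HasLaw Y standardGumbel P') :
    ((∀ M, ∀ᵐ ω ∂(P M), time₁ (C M) ω ≠ ⊤) ∧
      TendstoInDistribution
        (fun (M : ℕ+) (ω : Ω M) =>
          (((time₁ (C M) ω).toNat : ℝ)
              - ((ν₁ : ℝ) + lam * (ν₂ : ℝ)) * ((M : ℕ) : ℝ) * Real.log ((M : ℕ) : ℝ))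
            / (((ν₁ : ℝ) + lam * (ν₂ : ℝ)) * ((M : ℕ) : ℝ)) - Real.log (ν₁ : ℝ))
        atTop Y P P') ∧
    ((∀ M, ∀ᵐ ω ∂(P M), time₂ (C M) ω ≠ ⊤) ∧
      TendstoInDistribution
        (fun (M : ℕ+) (ω : Ω M) =>
          (((time₂ (C M) ω).toNat : ℝ)
              - (lam⁻¹ * (ν₁ : ℝ) + (ν₂ : ℝ)) * ((M : ℕ) : ℝ) * Real.log ((M : ℕ) : ℝ))
            / ((lam⁻¹ * (ν₁ : ℝ) + (ν₂ : ℝ)) * ((M : ℕ) : ℝ)) - Real.log (ν₂ : ℝ))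
        atTop Y P P') := by

  have (M : ℕ+) := measurableSingletonClass_sum (α := Fin (ν₁ * (M : ℕ)))
    (β := Fin (ν₂ * (M : ℕ)))
  have hν₁pos : (0 : ℝ) < ν₁ := by exact_mod_cast hν₁
  have hν₂pos : (0 : ℝ) < ν₂ := by exact_mod_cast hν₂
  have hMpos : ∀ M : ℕ+, (0 : ℝ) < (M : ℕ) := fun M => by exact_mod_cast M.pos
  have hp₂ : ∀ M, p₂ M = lam * p₁ M := fun M => (div_eq_iff (hp₁ M).ne').1 (hratio M)
  have hp₁_eq : ∀ M, p₁ M = ((ν₁ + lam * ν₂) * (M : ℕ))⁻¹ := by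
    intro M
    refine eq_inv_of_mul_eq_one_left ?_
    have := (hC M).total_prob_eq_one
    rw [hp₂] at this
    push_cast at this
    linarith
  -- Multiplying `p₁` by `lam` divides its constant `ν₁ + lam ν₂` by `lam`.
  have hp₂_eq : ∀ M, p₂ M = ((lam⁻¹ * ν₁ + ν₂) * (M : ℕ))⁻¹ := by
    intro M
    rw [hp₂, hp₁_eq]
    have := (hMpos M).ne'
    field_simp
  have hrange₁ : ∀ M : ℕ+, Set.range (Sum.inl : _ → Fin (ν₁ * (M : ℕ)) ⊕ Fin (ν₂ * (M : ℕ))) =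
      ((Finset.univ.map Function.Embedding.inl :
        Finset (Fin (ν₁ * (M : ℕ)) ⊕ Fin (ν₂ * (M : ℕ)))) : Set _) := by
    intro M; simp
  have hrange₂ : ∀ M : ℕ+, Set.range (Sum.inr : _ → Fin (ν₁ * (M : ℕ)) ⊕ Fin (ν₂ * (M : ℕ))) =
      ((Finset.univ.map Function.Embedding.inr :
        Finset (Fin (ν₁ * (M : ℕ)) ⊕ Fin (ν₂ * (M : ℕ)))) : Set _) := by
    intro M; simp
  constructor
  · simp only [time₁, hrange₁]
    refine detectionTime_tendstoInDistribution_gumbel hν₁ (by positivity)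
      (le_add_of_nonneg_right (by positivity)) (fun M => (hC M).measurable)
      (fun M => (hC M).indep) (fun M => by simp) (fun M n c hc => ?_) hY
    obtain ⟨i, -, rfl⟩ := Finset.mem_map.1 hc
    exact ((hC M).prob_group1 n i).trans (hp₁_eq M)
  · simp only [time₂, hrange₂]
    refine detectionTime_tendstoInDistribution_gumbel hν₂ (by positivity)
      (le_add_of_nonneg_left (by positivity)) (fun M => (hC M).measurable)
      (fun M => (hC M).indep) (fun M => by simp) (fun M n c hc => ?_) hY
    obtain ⟨i, -, rfl⟩ := Finset.mem_map.1 hc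
    exact ((hC M).prob_group2 n i).trans (hp₂_eq M)
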